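/- Let $p\le n$, let $\mathrm{St}(p,n)=\{X\in\mathbb{R}^{n\times p}: X^\top X=I_p\}$, and let $\mathbb{R}^{n\times p}_*$ be the set of $n\times p$ real matrices of full column rank. Let $f:\mathbb{R}^{n\times p}\to\mathbb{R}$ be continuously differentiable with locally Lipschitz continuous Euclidean gradient $\nabla f$ (with respect to the Frobenius inner product), and let $\lambda>0$. Define $$\psi(X)=2\,\mathrm{skew}\big(\nabla f(X)X^\top\big),\qquad \mathcal N(X)=\tfrac14\|X^\top X-I_p\|_{\mathrm F}^2,\qquad \Lambda(X)=\psi(X)X+\lambda\nabla\mathcal N(X),$$ where $\mathrm{skew}(A)=\frac12(A-A^\top)$. A critical point of $f$ relative to $\mathrm{St}(p,n)$ is a point $X\in\mathrm{St}(p,n)$ with $\mathrm Df(X)[\xi]=0$ for all $\xi$ in the tangent space $\{\xi\in\mathbb{R}^{n\times p}:\xi^\top X+X^\top\xi=0\}$; it is isolated if some neighbourhood of it contains no other critical point of $f$ relative to $\mathrm{St}(p,n)$. For every $X_0\in\mathbb{R}^{n\times p}_*$, the landing system $\dot X(t)=-\Lambda(X(t))$, $X(0)=X_0$, has a unique solution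 $t\mapsto\varphi_t(X_0)$ on $[0,\infty)$, and the following holds: if $X^*$ is a local minimum of $f$ on $\mathrm{St}(p,n)$ and an isolated critical point of $f$ relative to $\mathrm{St}(p,n)$, and if $X^*$ is an $\omega$-limit point of $\varphi_t(X_0)$ (that is, $\varphi_{t_k}(X_0)\to X^*$ for some sequence $t_k\to+\infty$), then $\lim_{t\to+\infty}\varphi_t(X_0)=X^*$. -/

import Mathlib

open Set Filter Topology Matrix
open scoped Matrix.Norms.Frobenius

noncomputable section

namespace Landing

variable {n p : ℕ}

/-- Real `n × p` matrices of full column rank. -/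
def fullRank (n p : ℕ) : Set (Matrix (Fin n) (Fin p) ℝ) := {X | X.rank = p}

/-- The Stiefel manifold `St(p,n)`. -/
def stiefel (n p : ℕ) : Set (Matrix (Fin n) (Fin p) ℝ) := {X | Xᵀ * X = 1}

/-- The tangent space of the Stiefel manifold at `X`. -/
def tangentSpace (X : Matrix (Fin n) (Fin p) ℝ) : Set (Matrix (Fin n) (Fin p) ℝ) :=
  {ξ | ξᵀ * X + Xᵀ * ξ = 0}

/-- The Euclidean gradient with respect to the Frobenius inner product: the matrix of partial
derivatives. -/
def grad (f : Matrix (Fin n) (Fin p) ℝ → ℝ) (X : Matrix (Fin n) (Fin p) ℝ) :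
    Matrix (Fin n) (Fin p) ℝ :=
  Matrix.of fun i j => fderiv ℝ f X (Matrix.single i j 1)

/-- The skew-symmetric part of a square matrix. -/
def skewPart (A : Matrix (Fin n) (Fin n) ℝ) : Matrix (Fin n) (Fin n) ℝ :=
  (1 / 2 : ℝ) • (A - Aᵀ)

/-- `ψ(X) = 2 skew(∇f(X) Xᵀ)`. -/
def psi (f : Matrix (Fin n) (Fin p) ℝ → ℝ) (X : Matrix (Fin n) (Fin p) ℝ) :
    Matrix (Fin n) (Fin n) ℝ :=
  (2 : ℝ) • skewPart (grad f X * Xᵀ)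

/-- The penalty `𝒩(X) = ¼ ‖Xᵀ X - I‖²`, in the Frobenius norm. -/
def penalty (X : Matrix (Fin n) (Fin p) ℝ) : ℝ := (1 / 4 : ℝ) * ‖Xᵀ * X - 1‖ ^ 2

/-- The landing field `Λ(X) = ψ(X) X + λ ∇𝒩(X)`. -/
def landingField (f : Matrix (Fin n) (Fin p) ℝ → ℝ) (lam : ℝ)
    (X : Matrix (Fin n) (Fin p) ℝ) : Matrix (Fin n) (Fin p) ℝ :=
  psi f X * X + lam • grad penalty X

/-- `φ` restricted to `[0, ∞)` solves the landing system `Ẋ = -Λ(X)`, `X(0) = X₀`. The values of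
`φ` at negative times are irrelevant. -/
def IsLandingSolution (f : Matrix (Fin n) (Fin p) ℝ → ℝ) (lam : ℝ)
    (X₀ : Matrix (Fin n) (Fin p) ℝ) (φ : ℝ → Matrix (Fin n) (Fin p) ℝ) : Prop :=
  φ 0 = X₀ ∧ IsIntegralCurveOn φ (fun _ X => -landingField f lam X) (Ici 0)

/-- The critical points of `f` relative to `St(p,n)`: the differential of `f` vanishes on the
tangent space. -/
def criticalSet (f : Matrix (Fin n) (Fin p) ℝ → ℝ) : Set (Matrix (Fin n) (Fin p) ℝ) :=
  {X | X ∈ stiefel n p ∧ ∀ ξ ∈ tangentSpace X, fderiv ℝ f X ξ = 0}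

/-- A critical point relative to `St(p,n)` with no other critical point in a neighbourhood. -/
def IsIsolatedCriticalPoint (f : Matrix (Fin n) (Fin p) ℝ → ℝ)
    (X : Matrix (Fin n) (Fin p) ℝ) : Prop :=
  X ∈ criticalSet f ∧ ∃ U ∈ 𝓝 X, ∀ Y ∈ U, Y ∈ criticalSet f → Y = X

/-- `X` is an `ω`-limit point of the trajectory `φ`. -/
def IsOmegaLimitPoint (φ : ℝ → Matrix (Fin n) (Fin p) ℝ)
    (X : Matrix (Fin n) (Fin p) ℝ) : Prop :=
  ∃ t : ℕ → ℝ, Tendsto t atTop atTop ∧ Tendsto (fun k => φ (t k)) atTop (𝓝 X)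

end Landing

end

/-! The two parts of the field do separate work. Since `ψ(X)` is skew, `ψ(X)X` is tangent to the
level sets of the penalty, so the penalty decreases at rate `λ‖∇𝒩‖²`
(`fderiv_penalty_landingField`). This confines every trajectory to a ball, which gives global
existence. Along `-ψ(X)X` the objective decreases at rate `½‖ψ‖²` (`fderiv_psi_mul`).

An ω-limit point on the Stiefel manifold forces the monotone penalty to zero. Near the manifold `∇𝒩`
dominates the penalty, so the decay is exponential, and the drift that the penalty term causes in
`f` is integrable: `f` plus a decaying exponential is eventually antitone
(`exists_antitoneOn_add_exp`). Hence `f` converges along the trajectory to `f(X*)`.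

If the trajectory did not converge, it would cross a small sphere around `X*` at arbitrarily late
times. A cluster point `Y` on that sphere lies on the manifold with `f(Y) = f(X*)`, so it is itself
a local minimum, hence critical, against isolation. -/

namespace Landing

/-! ### Uniqueness and global existence for locally Lipschitz fields -/

section ODE

variable {E : Type*} [NormedAddCommGroup E]

theorem exists_lipschitzOnWith_closedBall [ProperSpace E] {v : E → E} (hv : LocallyLipschitz v)
    (x : E) (r : ℝ) : ∃ K, LipschitzOnWith K v (Metric.closedBall x r) :=
  hv.locallyLipschitzOn.exists_lipschitzOnWith_of_compact (isCompact_closedBall x r)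

variable [NormedSpace ℝ E]

/-- The pointwise product of a locally Lipschitz scalar function and a locally Lipschitz vector
field is locally Lipschitz. -/
theorem locallyLipschitz_smul {c : E → ℝ} {v : E → E} (hc : LocallyLipschitz c)
    (hv : LocallyLipschitz v) : LocallyLipschitz fun x => c x • v x := by
  have h : ContDiff ℝ 1 fun q : ℝ × E => q.1 • q.2 := contDiff_fst.smul contDiff_snd
  exact h.locallyLipschitz.comp (hc.prodMk hv)

/-- Integral curves of a locally Lipschitz field on `[0, T]` are determined by their initial
value. -/
theorem integralCurve_eqOn_Icc [ProperSpace E] {v : E → E} (hv : LocallyLipschitz v)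
    {γ χ : ℝ → E} {T : ℝ} (hγ : IsIntegralCurveOn γ (fun _ => v) (Icc 0 T))
    (hχ : IsIntegralCurveOn χ (fun _ => v) (Icc 0 T)) (h0 : γ 0 = χ 0) :
    EqOn γ χ (Icc 0 T) := by
  obtain ⟨r, hr⟩ := (isCompact_Icc.image_of_continuousOn hγ.continuousOn).isBounded.union
    (isCompact_Icc.image_of_continuousOn hχ.continuousOn).isBounded |>.subset_closedBall 0
  obtain ⟨K, hK⟩ := exists_lipschitzOnWith_closedBall hv 0 r
  have key : ∀ α : ℝ → E, IsIntegralCurveOn α (fun _ => v) (Icc 0 T) →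
      ∀ t ∈ Ico 0 T, HasDerivWithinAt α (v (α t)) (Ici t) t := by
    intro α hα t ht
    refine (hα t (Ico_subset_Icc_self ht)).mono_of_mem_nhdsWithin ?_
    exact mem_of_superset (Icc_mem_nhdsGE ht.2) (Icc_subset_Icc_left ht.1)
  exact ODE_solution_unique_of_mem_Icc_right (v := fun _ => v)
    (s := fun _ => Metric.closedBall 0 r) (K := K)
    (fun _ _ => hK) hγ.continuousOn (key γ hγ)
    (fun t ht => hr (Or.inl (mem_image_of_mem _ (Ico_subset_Icc_self ht)))) hχ.continuousOn
    (key χ hχ) (fun t ht => hr (Or.inr (mem_image_of_mem _ (Ico_subset_Icc_self ht)))) h0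

theorem integralCurve_eqOn_Ici [ProperSpace E] {v : E → E} (hv : LocallyLipschitz v)
    {γ χ : ℝ → E} (hγ : IsIntegralCurveOn γ (fun _ => v) (Ici 0))
    (hχ : IsIntegralCurveOn χ (fun _ => v) (Ici 0)) (h0 : γ 0 = χ 0) :
    EqOn γ χ (Ici 0) := fun _ ht =>
  integralCurve_eqOn_Icc hv (hγ.mono Icc_subset_Ici_self) (hχ.mono Icc_subset_Ici_self) h0
    (right_mem_Icc.2 ht)

/-- A bounded locally Lipschitz field has integral curves on every interval `[0, T]`. -/
theorem exists_integralCurveOn_Icc_of_bounded [ProperSpace E] {v : E → E}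
    (hv : LocallyLipschitz v) {L : ℝ} (hL : ∀ x, ‖v x‖ ≤ L) (x₀ : E) {T : ℝ} (hT : 0 ≤ T) :
    ∃ γ : ℝ → E, γ 0 = x₀ ∧ IsIntegralCurveOn γ (fun _ => v) (Icc 0 T) := by
  have hL0 : 0 ≤ L := (norm_nonneg _).trans (hL x₀)
  lift L to NNReal using hL0
  obtain ⟨K, hK⟩ := exists_lipschitzOnWith_closedBall hv x₀ (L * T)
  -- A curve of speed at most `L` travels at most `L * T` in time `T`, so a ball of this radius
  -- allows the whole interval.
  have hP : IsPicardLindelof (fun _ => v) (tmin := 0) (tmax := T) ⟨0, left_mem_Icc.2 hT⟩ x₀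
      (L * ⟨T, hT⟩) 0 L K :=
    { lipschitzOnWith := fun _ _ => hK
      continuousOn := fun _ _ => continuousOn_const
      norm_le := fun _ _ x _ => hL x
      mul_max_le := by
        rw [sub_zero, sub_self, max_eq_left hT, NNReal.coe_zero, sub_zero]
        exact le_rfl }
  obtain ⟨γ, h0, hγ⟩ := hP.exists_eq_forall_mem_Icc_hasDerivWithinAt₀
  exact ⟨γ, h0, hγ⟩

/-- Integral curves on the intervals `[0, T]` with a common initial value glue to one on
`[0, ∞)`. -/
theorem exists_integralCurveOn_Ici [ProperSpace E] {v : E → E} (hv : LocallyLipschitz v) (x₀ : E)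
    (h : ∀ T : ℝ, 0 ≤ T → ∃ γ : ℝ → E, γ 0 = x₀ ∧ IsIntegralCurveOn γ (fun _ => v) (Icc 0 T)) :
    ∃ γ : ℝ → E, γ 0 = x₀ ∧ IsIntegralCurveOn γ (fun _ => v) (Ici 0) := by
  choose! α hα0 hα using h
  have agree : ∀ s t, 0 ≤ s → s ≤ t + 1 → 0 ≤ t → α (s + 1) s = α (t + 1) s := by
    intro s t hs hst ht
    have h1 := hα (s + 1) (by linarith)
    have h2 := hα (t + 1) (by linarith)
    exact integralCurve_eqOn_Icc hv (T := s) (h1.mono (Icc_subset_Icc_right (by linarith)))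
      (h2.mono (Icc_subset_Icc_right hst))
      ((hα0 _ (by linarith)).trans (hα0 _ (by linarith)).symm) (right_mem_Icc.2 hs)
  -- The spare unit of time makes `[0, t + 1]` a neighbourhood of `t` within `[0, ∞)`.
  refine ⟨fun t => α (t + 1) t, hα0 _ (by norm_num), fun t ht => ?_⟩
  have ht0 : (0 : ℝ) ≤ t := ht
  have hmem : Icc 0 (t + 1) ∈ 𝓝[Ici 0] t := by
    rw [← Ici_inter_Iic]
    exact inter_mem_nhdsWithin _ (Iic_mem_nhds (by linarith))
  have h1 := (hα (t + 1) (by linarith) t ⟨ht0, by linarith⟩).mono_of_mem_nhdsWithin hmem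
  exact h1.congr_of_eventuallyEq
    (by filter_upwards [hmem] with s hs using agree s t hs.1 hs.2 ht0) rfl

/-- A locally Lipschitz field has a global forward integral curve from `x₀` as soon as the
integral curves from `x₀` of all its nonnegative scalar rescalings stay in a fixed ball. -/
theorem exists_integralCurveOn_Ici_of_norm_le [ProperSpace E] {v : E → E}
    (hv : LocallyLipschitz v) (x₀ : E) (R : ℝ)
    (h : ∀ c : E → ℝ, (∀ x, 0 ≤ c x) → ∀ (γ : ℝ → E) (T : ℝ), γ 0 = x₀ →
      IsIntegralCurveOn γ (fun _ x => c x • v x) (Icc 0 T) → ∀ t ∈ Icc 0 T, ‖γ t‖ ≤ R) :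
    ∃ γ : ℝ → E, γ 0 = x₀ ∧ IsIntegralCurveOn γ (fun _ => v) (Ici 0) := by
  refine exists_integralCurveOn_Ici hv x₀ fun T hT => ?_
  -- A cutoff equal to 1 on the ball of radius `R` and 0 beyond `R + 1` makes the field bounded. The
  -- a priori bound `h` keeps its curves where `c = 1`, so they solve the original equation.
  set c : E → ℝ := fun x => min (max (R + 1 - ‖x‖) 0) 1 with hc
  have hnorm : LocallyLipschitz fun x : E => R + 1 - ‖x‖ := by
    have h1 : ContDiff ℝ 1 fun r : ℝ => R + 1 - r := contDiff_const.sub contDiff_id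
    exact h1.locallyLipschitz.comp lipschitzWith_one_norm.locallyLipschitz
  have hcl : LocallyLipschitz c := (hnorm.max_const 0).min_const 1
  have hc0 : ∀ x, 0 ≤ c x := fun x => le_min (le_max_right _ _) zero_le_one
  have hc1 : ∀ x, ‖x‖ ≤ R → c x = 1 := fun x hx =>
    min_eq_right (le_max_of_le_left (by linarith))
  have hcz : ∀ x, R + 1 < ‖x‖ → c x = 0 := fun x hx => by
    simp [hc, max_eq_right (show R + 1 - ‖x‖ ≤ 0 by linarith)]
  have hcv := locallyLipschitz_smul hcl hv
  obtain ⟨L, hL⟩ := (isCompact_closedBall (0 : E) (R + 1)).exists_bound_of_continuousOn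
    hcv.continuous.continuousOn
  have hbound : ∀ x, ‖c x • v x‖ ≤ max L 0 := by
    intro x
    rcases le_or_gt ‖x‖ (R + 1) with hx | hx
    · exact (hL x (by simpa using hx)).trans (le_max_left _ _)
    · simp [hcz x hx]
  obtain ⟨γ, h0, hγ⟩ := exists_integralCurveOn_Icc_of_bounded hcv hbound x₀ hT
  refine ⟨γ, h0, fun t ht => ?_⟩
  have := hγ t ht
  simpa only [hc1 _ (h c hc0 γ T h0 hγ t ht), one_smul] using this

end ODE

/-- An antitone function on a half-line converges to each of its limits along sequences tending
to infinity. -/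
theorem tendsto_of_antitoneOn_Ici {g : ℝ → ℝ} {a l : ℝ} (hg : AntitoneOn g (Ici a)) {u : ℕ → ℝ}
    (hu : Tendsto u atTop atTop) (hgu : Tendsto (fun k => g (u k)) atTop (𝓝 l)) :
    Tendsto g atTop (𝓝 l) := by
  have hlow : ∀ t ∈ Ici a, l ≤ g t := by
    intro t ht
    refine le_of_tendsto hgu ?_
    filter_upwards [hu.eventually_ge_atTop t] with k hk
    exact hg ht (le_trans (mem_Ici.1 ht) hk) hk
  rw [tendsto_order]
  refine ⟨fun b hb => ?_, fun b hb => ?_⟩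
  · filter_upwards [eventually_ge_atTop a] with t ht using hb.trans_le (hlow t ht)
  · obtain ⟨k, hk, hka⟩ := ((hgu.eventually_lt_const hb).and (hu.eventually_ge_atTop a)).exists
    filter_upwards [eventually_ge_atTop (u k)] with t ht
    exact (hg hka (le_trans hka ht) ht).trans_lt hk

/-- A function on an interval with nonpositive one-sided derivatives within it is antitone. -/
theorem antitoneOn_of_hasDerivWithinAt_nonpos {s : Set ℝ} (hs : Convex ℝ s) {g g' : ℝ → ℝ}
    (hg : ∀ t ∈ s, HasDerivWithinAt g (g' t) s t) (h : ∀ t ∈ s, g' t ≤ 0) : AntitoneOn g s := by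
  refine antitoneOn_of_deriv_nonpos hs (fun t ht => (hg t ht).continuousWithinAt) ?_ ?_
  · intro t ht
    exact ((hg t (interior_subset ht)).hasDerivAt
      (mem_interior_iff_mem_nhds.1 ht)).differentiableAt.differentiableWithinAt
  · intro t ht
    rw [((hg t (interior_subset ht)).hasDerivAt (mem_interior_iff_mem_nhds.1 ht)).deriv]
    exact h t (interior_subset ht)

/-! ### Differentiation in normed spaces -/

section Normed

variable {E F : Type*} [NormedAddCommGroup E] [NormedSpace ℝ E] [NormedAddCommGroup F]
  [NormedSpace ℝ F]

theorem _root_.LinearMap.contDiff_comp_of_finiteDimensional {G : Type*} [NormedAddCommGroup G]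
    [NormedSpace ℝ G] [FiniteDimensional ℝ F] (l : F →ₗ[ℝ] G) {a : E → F} (ha : ContDiff ℝ 1 a) :
    ContDiff ℝ 1 fun x => l (a x) :=
  (LinearMap.toContinuousLinearMap l).contDiff.comp ha

theorem _root_.LinearMap.exists_abs_le [FiniteDimensional ℝ E] (l : E →ₗ[ℝ] ℝ) :
    ∃ c : ℝ, 0 ≤ c ∧ ∀ x, |l x| ≤ c * ‖x‖ :=
  ⟨‖LinearMap.toContinuousLinearMap l‖, norm_nonneg _,
    (LinearMap.toContinuousLinearMap l).le_opNorm⟩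

theorem exists_abs_fderiv_le_on_closedBall [ProperSpace E] {f : E → ℝ} (hf : ContDiff ℝ 1 f)
    (R : ℝ) : ∃ K : ℝ, 0 ≤ K ∧ ∀ x, ‖x‖ ≤ R → ∀ ξ, |fderiv ℝ f x ξ| ≤ K * ‖ξ‖ := by
  obtain ⟨K, hK⟩ := (isCompact_closedBall (0 : E) R).exists_bound_of_continuousOn
    (hf.continuous_fderiv one_ne_zero).continuousOn
  refine ⟨|K|, abs_nonneg K, fun x hx ξ => ?_⟩
  refine ((fderiv ℝ f x).le_opNorm ξ).trans ?_
  gcongr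
  exact (hK x (by simpa using hx)).trans (le_abs_self K)

theorem fderiv_eq_of_hasDerivAt_line {f : E → ℝ} (hf : ContDiff ℝ 1 f) {x ξ : E} {a : ℝ}
    (h : HasDerivAt (fun t : ℝ => f (x + t • ξ)) a 0) : fderiv ℝ f x ξ = a :=
  ((hf.differentiable one_ne_zero x).hasFDerivAt.hasLineDerivAt ξ).unique h

theorem hasDerivWithinAt_comp_curve {f : E → ℝ} (hf : ContDiff ℝ 1 f) {γ : ℝ → E} {γ' : E}
    {s : Set ℝ} {t : ℝ} (h : HasDerivWithinAt γ γ' s t) :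
    HasDerivWithinAt (fun u => f (γ u)) (fderiv ℝ f (γ t) γ') s t :=
  (hf.differentiable one_ne_zero (γ t)).hasFDerivAt.comp_hasDerivWithinAt t h

theorem locallyLipschitz_comp_graph {G : Type*} [NormedAddCommGroup G] [NormedSpace ℝ G]
    {Φ : F × E → G} (hΦ : ContDiff ℝ 1 Φ) {g : E → F} (hg : LocallyLipschitz g) :
    LocallyLipschitz fun x => Φ (g x, x) :=
  hΦ.locallyLipschitz.comp (hg.prodMk LocallyLipschitz.id)

end Normed

/-! ### Matrix calculus of the penalty and of the landing field -/

section Calculus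

variable {n p : ℕ}

theorem norm_sq_eq_trace {m k : ℕ} (A : Matrix (Fin m) (Fin k) ℝ) :
    ‖A‖ ^ 2 = trace (Aᵀ * A) := by
  rw [frobenius_norm_def, ← Real.sqrt_eq_rpow, Real.sq_sqrt (by positivity), Finset.sum_comm]
  simp [trace, Matrix.mul_apply, ← sq]

theorem trace_transpose_mul_single (A : Matrix (Fin n) (Fin p) ℝ) (i : Fin n) (j : Fin p) :
    trace (Aᵀ * Matrix.single i j (1 : ℝ)) = A i j := by
  rw [Matrix.trace_mul_single]
  simp

theorem fderiv_eq_trace_grad (f : Matrix (Fin n) (Fin p) ℝ → ℝ)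
    (X ξ : Matrix (Fin n) (Fin p) ℝ) : fderiv ℝ f X ξ = trace ((grad f X)ᵀ * ξ) := by
  conv_lhs => rw [matrix_eq_sum_single ξ]
  conv_rhs => rw [matrix_eq_sum_single ξ]
  simp only [map_sum, Matrix.mul_sum, trace_sum]
  refine Finset.sum_congr rfl fun i _ => Finset.sum_congr rfl fun j _ => ?_
  have : Matrix.single i j (ξ i j) = ξ i j • Matrix.single i j (1 : ℝ) := by simp
  rw [this, map_smul, Matrix.mul_smul, trace_smul, trace_transpose_mul_single]
  rfl

theorem isBoundedBilinearMap_matrix_mul (l m k : ℕ) :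
    IsBoundedBilinearMap ℝ
      fun q : Matrix (Fin l) (Fin m) ℝ × Matrix (Fin m) (Fin k) ℝ => q.1 * q.2 where
  add_left := Matrix.add_mul
  smul_left c A B := Matrix.smul_mul c A B
  add_right := Matrix.mul_add
  smul_right c A B := Matrix.mul_smul A c B
  bound := ⟨1, one_pos, fun A B => by simpa using frobenius_norm_mul A B⟩

theorem _root_.ContDiff.matrix_mul {E : Type*} [NormedAddCommGroup E] [NormedSpace ℝ E]
    {l m k : ℕ} {a : E → Matrix (Fin l) (Fin m) ℝ} {b : E → Matrix (Fin m) (Fin k) ℝ}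
    (ha : ContDiff ℝ 1 a) (hb : ContDiff ℝ 1 b) : ContDiff ℝ 1 fun x => a x * b x :=
  (isBoundedBilinearMap_matrix_mul l m k).contDiff.comp (ha.prodMk hb)

theorem _root_.ContDiff.matrix_transpose_fin {E : Type*} [NormedAddCommGroup E]
    [NormedSpace ℝ E] {m k : ℕ} {a : E → Matrix (Fin m) (Fin k) ℝ} (ha : ContDiff ℝ 1 a) :
    ContDiff ℝ 1 fun x => (a x)ᵀ :=
  (Matrix.transposeLinearEquiv (Fin m) (Fin k) ℝ ℝ).toLinearMap.contDiff_comp_of_finiteDimensional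
    ha

theorem _root_.ContDiff.matrix_trace {E : Type*} [NormedAddCommGroup E]
    [NormedSpace ℝ E] {m : ℕ} {a : E → Matrix (Fin m) (Fin m) ℝ} (ha : ContDiff ℝ 1 a) :
    ContDiff ℝ 1 fun x => trace (a x) :=
  (Matrix.traceLinearMap (Fin m) ℝ ℝ).contDiff_comp_of_finiteDimensional ha

theorem transpose_gram (X : Matrix (Fin n) (Fin p) ℝ) : (Xᵀ * X - 1)ᵀ = Xᵀ * X - 1 := by
  simp

theorem penalty_eq_trace (X : Matrix (Fin n) (Fin p) ℝ) :
    penalty X = (1 / 4 : ℝ) * trace ((Xᵀ * X - 1) * (Xᵀ * X - 1)) := by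
  rw [penalty, norm_sq_eq_trace, transpose_gram]

theorem contDiff_penalty : ContDiff ℝ 1 (penalty : Matrix (Fin n) (Fin p) ℝ → ℝ) := by
  have h1 : ContDiff ℝ 1 fun X : Matrix (Fin n) (Fin p) ℝ => Xᵀ * X - 1 :=
    ((contDiff_id.matrix_transpose_fin).matrix_mul contDiff_id).sub contDiff_const
  rw [show (penalty : Matrix (Fin n) (Fin p) ℝ → ℝ) = _ from funext penalty_eq_trace]
  exact contDiff_const.mul (h1.matrix_mul h1).matrix_trace

theorem fderiv_penalty (X ξ : Matrix (Fin n) (Fin p) ℝ) :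
    fderiv ℝ penalty X ξ = trace ((X * (Xᵀ * X - 1))ᵀ * ξ) := by
  refine fderiv_eq_of_hasDerivAt_line contDiff_penalty ?_
  set A := Xᵀ * X - 1 with hA
  set B := ξᵀ * X + Xᵀ * ξ with hB
  set C := ξᵀ * ξ with hC
  -- On a line the penalty is a quartic polynomial in `t`; only its linear coefficient matters.
  have hline : ∀ t : ℝ, penalty (X + t • ξ) = (1 / 4 : ℝ) * (trace (A * A) +
      t * (2 * trace (A * B)) + t ^ 2 * (trace (B * B) + 2 * trace (A * C)) +
      t ^ 3 * (2 * trace (B * C)) + t ^ 4 * trace (C * C)) := by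
    intro t
    have h : (X + t • ξ)ᵀ * (X + t • ξ) - 1 = A + t • B + t ^ 2 • C := by
      rw [hA, hB, hC]
      simp only [transpose_add, transpose_smul, Matrix.add_mul, Matrix.mul_add, Matrix.smul_mul,
        Matrix.mul_smul, smul_add, smul_smul]
      rw [← sq]
      abel
    rw [penalty_eq_trace, h]
    simp only [Matrix.add_mul, Matrix.mul_add, Matrix.smul_mul, Matrix.mul_smul, trace_add,
      trace_smul, smul_eq_mul, trace_mul_comm B A, trace_mul_comm C A, trace_mul_comm C B]
    ring
  have hBA : trace (A * B) = 2 * trace ((X * A)ᵀ * ξ) := by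
    have h1 : Aᵀ = A := transpose_gram X
    have h2 : trace (A * (ξᵀ * X)) = trace (A * (Xᵀ * ξ)) := by
      rw [← trace_transpose, transpose_mul, transpose_mul, transpose_transpose, h1,
        trace_mul_comm]
    rw [hB, Matrix.mul_add, trace_add, h2, transpose_mul, h1, Matrix.mul_assoc]
    ring
  have hid := hasDerivAt_id (0 : ℝ)
  have hd := (((((hid.mul_const (2 * trace (A * B))).const_add (trace (A * A))).add
    ((hid.pow 2).mul_const (trace (B * B) + 2 * trace (A * C)))).add
    ((hid.pow 3).mul_const (2 * trace (B * C)))).add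
    ((hid.pow 4).mul_const (trace (C * C)))).const_mul (1 / 4 : ℝ)
  refine (hd.congr_of_eventuallyEq (Eventually.of_forall hline)).congr_deriv ?_
  simp [hBA]
  ring

theorem grad_penalty (X : Matrix (Fin n) (Fin p) ℝ) : grad penalty X = X * (Xᵀ * X - 1) := by
  ext i j
  rw [← trace_transpose_mul_single (X * (Xᵀ * X - 1)), ← fderiv_penalty]
  rfl

theorem penalty_nonneg (X : Matrix (Fin n) (Fin p) ℝ) : 0 ≤ penalty X := by
  unfold penalty; positivity

theorem penalty_eq_zero_iff {X : Matrix (Fin n) (Fin p) ℝ} : penalty X = 0 ↔ X ∈ stiefel n p := by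
  simp [penalty, stiefel, sub_eq_zero]

theorem psi_eq (f : Matrix (Fin n) (Fin p) ℝ → ℝ) (X : Matrix (Fin n) (Fin p) ℝ) :
    psi f X = grad f X * Xᵀ - X * (grad f X)ᵀ := by
  simp [psi, skewPart, smul_smul]

theorem transpose_psi (f : Matrix (Fin n) (Fin p) ℝ → ℝ) (X : Matrix (Fin n) (Fin p) ℝ) :
    (psi f X)ᵀ = -psi f X := by
  simp [psi_eq]

theorem landingField_eq (f : Matrix (Fin n) (Fin p) ℝ → ℝ) (lam : ℝ)
    (X : Matrix (Fin n) (Fin p) ℝ) :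
    landingField f lam X =
      (grad f X * Xᵀ - X * (grad f X)ᵀ) * X + lam • (X * (Xᵀ * X - 1)) := by
  rw [landingField, psi_eq, grad_penalty]

theorem contDiff_landingField_expr (n p : ℕ) (lam : ℝ) :
    ContDiff ℝ 1 fun q : Matrix (Fin n) (Fin p) ℝ × Matrix (Fin n) (Fin p) ℝ =>
      (q.1 * q.2ᵀ - q.2 * q.1ᵀ) * q.2 + lam • (q.2 * (q.2ᵀ * q.2 - 1)) := by
  have h1 : ContDiff ℝ 1 fun q : Matrix (Fin n) (Fin p) ℝ × Matrix (Fin n) (Fin p) ℝ => q.1 :=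
    contDiff_fst
  have h2 : ContDiff ℝ 1 fun q : Matrix (Fin n) (Fin p) ℝ × Matrix (Fin n) (Fin p) ℝ => q.2 :=
    contDiff_snd
  have h3 := (h1.matrix_mul h2.matrix_transpose_fin).sub (h2.matrix_mul h1.matrix_transpose_fin)
  have h4 := h2.matrix_mul ((h2.matrix_transpose_fin.matrix_mul h2).sub
    (contDiff_const (c := (1 : Matrix (Fin p) (Fin p) ℝ))))
  exact (h3.matrix_mul h2).add (h4.const_smul lam)

theorem locallyLipschitz_landingField {f : Matrix (Fin n) (Fin p) ℝ → ℝ}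
    (hgrad : LocallyLipschitz (grad f)) (lam : ℝ) :
    LocallyLipschitz fun X => -landingField f lam X := by
  have h := locallyLipschitz_comp_graph (contDiff_landingField_expr n p lam).neg hgrad
  have he : (fun X => -landingField f lam X) = fun X => -((grad f X * Xᵀ - X * (grad f X)ᵀ) * X +
      lam • (X * (Xᵀ * X - 1))) := funext fun X => by rw [landingField_eq]
  rw [he]
  exact h

theorem trace_transpose_mul_of_skew {S : Matrix (Fin p) (Fin p) ℝ} {K : Matrix (Fin p) (Fin p) ℝ}
    (hS : Sᵀ = S) (hK : Kᵀ = -K) : trace (S * K) = 0 := by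
  have h : trace (S * K) = -trace (S * K) := by
    conv_lhs => rw [← trace_transpose, transpose_mul, hS, hK, Matrix.neg_mul, trace_neg,
      trace_mul_comm]
  linarith

/-- The `ψ` term contributes the trace of the symmetric `XᵀX - 1` times the skew `Xᵀψ(X)X`, which is
zero. -/
theorem fderiv_penalty_landingField (f : Matrix (Fin n) (Fin p) ℝ → ℝ) (lam : ℝ)
    (X : Matrix (Fin n) (Fin p) ℝ) :
    fderiv ℝ penalty X (landingField f lam X) = lam * ‖X * (Xᵀ * X - 1)‖ ^ 2 := by
  rw [fderiv_penalty, landingField, grad_penalty, Matrix.mul_add, trace_add, Matrix.mul_smul,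
    trace_smul, ← norm_sq_eq_trace, transpose_mul, transpose_gram, Matrix.mul_assoc,
    trace_transpose_mul_of_skew (transpose_gram X), zero_add, smul_eq_mul]
  simp [transpose_psi, Matrix.mul_assoc]

/-- The pairing is that of `∇f(X)Xᵀ` with the skew matrix `ψ(X)`, so only the skew part `½ψ(X)` of
the former counts. -/
theorem fderiv_psi_mul (f : Matrix (Fin n) (Fin p) ℝ → ℝ) (X : Matrix (Fin n) (Fin p) ℝ) :
    fderiv ℝ f X (psi f X * X) = (1 / 2 : ℝ) * ‖psi f X‖ ^ 2 := by
  have h1 : trace ((grad f X)ᵀ * (psi f X * X)) = trace (X * (grad f X)ᵀ * psi f X) := by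
    rw [← Matrix.mul_assoc, trace_mul_comm, Matrix.mul_assoc]
  have h2 : trace (X * (grad f X)ᵀ * psi f X) = -trace (grad f X * Xᵀ * psi f X) := by
    rw [← trace_transpose, transpose_mul, transpose_psi, Matrix.neg_mul, trace_neg,
      trace_mul_comm]
    simp
  have h3 : trace ((psi f X)ᵀ * psi f X) =
      trace (X * (grad f X)ᵀ * psi f X) - trace (grad f X * Xᵀ * psi f X) := by
    rw [transpose_psi, ← trace_sub, ← Matrix.sub_mul]
    congr 2
    rw [psi_eq, neg_sub]
  rw [fderiv_eq_trace_grad, norm_sq_eq_trace, h3, h1]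
  linarith

/-- A point of the Stiefel manifold at which `ψ` vanishes is critical. -/
theorem mem_criticalSet_of_psi_eq_zero {f : Matrix (Fin n) (Fin p) ℝ → ℝ}
    {X : Matrix (Fin n) (Fin p) ℝ} (hX : X ∈ stiefel n p) (h : psi f X = 0) :
    X ∈ criticalSet f := by
  refine ⟨hX, fun ξ hξ => ?_⟩
  have hX' : Xᵀ * X = 1 := hX
  have hξ' : ξᵀ * X + Xᵀ * ξ = 0 := hξ
  have hG : grad f X = X * ((grad f X)ᵀ * X) := by
    rw [psi_eq, sub_eq_zero] at h
    rw [← Matrix.mul_assoc, ← h, Matrix.mul_assoc, hX', Matrix.mul_one]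
  set A := (grad f X)ᵀ * X with hA
  have hAs : Aᵀ = A := by
    conv_rhs => rw [hA, hG, transpose_mul, Matrix.mul_assoc, hX', Matrix.mul_one]
  rw [fderiv_eq_trace_grad, hG, transpose_mul, hAs, Matrix.mul_assoc]
  refine trace_transpose_mul_of_skew hAs ?_
  simpa using eq_neg_of_add_eq_zero_left hξ'

/-- A bound on the penalty bounds the norm. -/
theorem exists_norm_le_of_penalty_le (n p : ℕ) (C : ℝ) :
    ∃ R : ℝ, 0 < R ∧ ∀ X : Matrix (Fin n) (Fin p) ℝ, penalty X ≤ C → ‖X‖ ≤ R := by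
  obtain ⟨c, hc, hc'⟩ := (Matrix.traceLinearMap (Fin p) ℝ ℝ).exists_abs_le
  set D : ℝ := c * (4 * C + 1) + p with hD
  refine ⟨|D| + 1, by positivity, fun X hX => ?_⟩
  have h1 : ‖Xᵀ * X - 1‖ ≤ 4 * C + 1 := by
    unfold penalty at hX
    nlinarith [sq_nonneg (‖Xᵀ * X - 1‖ - 1 / 2)]
  have h2 : ‖X‖ ^ 2 = trace (Xᵀ * X - 1) + p := by
    rw [norm_sq_eq_trace]; simp
  have h3 : trace (Xᵀ * X - 1) ≤ c * (4 * C + 1) :=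
    (le_abs_self _).trans ((hc' _).trans (by gcongr))
  have h4 : ‖X‖ ^ 2 ≤ |D| := by
    rw [h2]; exact le_trans (by linarith) (le_abs_self D)
  nlinarith [sq_nonneg (‖X‖ - 1), abs_nonneg D]

/-- Near the Stiefel manifold the gradient of the penalty dominates the penalty. -/
theorem penalty_le_norm_grad {X : Matrix (Fin n) (Fin p) ℝ} {R : ℝ} (hR : ‖X‖ ≤ R)
    (h : ‖Xᵀ * X - 1‖ ≤ 1 / 2) : penalty X ≤ R ^ 2 * ‖X * (Xᵀ * X - 1)‖ ^ 2 := by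
  set A := Xᵀ * X - 1 with hA
  have h1 : Xᵀ * (X * A) = A + A * A := by
    rw [← Matrix.mul_assoc, show Xᵀ * X = 1 + A by rw [hA]; abel, Matrix.add_mul, Matrix.one_mul]
  -- The quadratic term has norm at most `½‖A‖` and is absorbed on the left.
  have h2 : A = Xᵀ * (X * A) - A * A := by rw [h1]; abel
  have h3 : ‖A‖ ≤ R * ‖X * A‖ + ‖A‖ * (1 / 2) := by
    calc ‖A‖ = ‖Xᵀ * (X * A) - A * A‖ := congrArg norm h2
      _ ≤ ‖Xᵀ * (X * A)‖ + ‖A * A‖ := norm_sub_le _ _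
      _ ≤ ‖Xᵀ‖ * ‖X * A‖ + ‖A‖ * ‖A‖ :=
        add_le_add (frobenius_norm_mul _ _) (frobenius_norm_mul _ _)
      _ ≤ R * ‖X * A‖ + ‖A‖ * (1 / 2) := by
        rw [frobenius_norm_transpose]; gcongr
  have h4 : (1 / 2) * ‖A‖ ≤ R * ‖X * A‖ := by linarith
  calc penalty X = ((1 / 2) * ‖A‖) ^ 2 := by rw [penalty]; ring
    _ ≤ (R * ‖X * A‖) ^ 2 := by gcongr
    _ = _ := by ring

end Calculus

theorem eq_of_tendsto_of_mapClusterPt {α X : Type*} [TopologicalSpace X] [T2Space X]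
    {l : Filter α} {g : α → X} {x y : X} (h : Tendsto g l (𝓝 x)) (hy : MapClusterPt y l g) :
    y = x :=
  haveI : (𝓝 y ⊓ 𝓝 x).NeBot := ClusterPt.mono hy h
  eq_of_nhds_neBot this

/-! ### The landing flow and its limit -/

section Flow

variable {n p : ℕ} {f : Matrix (Fin n) (Fin p) ℝ → ℝ} {lam : ℝ}
  {φ : ℝ → Matrix (Fin n) (Fin p) ℝ}

instance : ProperSpace (Matrix (Fin n) (Fin p) ℝ) := FiniteDimensional.proper_real _

theorem hasDerivWithinAt_comp_matrix_curve {g : Matrix (Fin n) (Fin p) ℝ → ℝ}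
    (hg : ContDiff ℝ 1 g) {ξ : Matrix (Fin n) (Fin p) ℝ} {s : Set ℝ} {t : ℝ}
    (h : HasDerivWithinAt φ ξ s t) :
    HasDerivWithinAt (fun u => g (φ u)) (fderiv ℝ g (φ t) ξ) s t :=
  hasDerivWithinAt_comp_curve hg h

theorem exists_abs_matrix_fderiv_le (hf : ContDiff ℝ 1 f) (R : ℝ) :
    ∃ K : ℝ, 0 ≤ K ∧ ∀ X, ‖X‖ ≤ R → ∀ ξ, |fderiv ℝ f X ξ| ≤ K * ‖ξ‖ :=
  exists_abs_fderiv_le_on_closedBall hf R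

/-- The penalty decreases along integral curves of nonnegative rescalings of the landing field. -/
theorem antitoneOn_penalty_of_rescaled (hlam : 0 < lam) {c : Matrix (Fin n) (Fin p) ℝ → ℝ}
    (hc : ∀ X, 0 ≤ c X) {s : Set ℝ} (hs : Convex ℝ s)
    (hφ : IsIntegralCurveOn φ (fun _ X => c X • -landingField f lam X) s) :
    AntitoneOn (fun t => penalty (φ t)) s := by
  refine antitoneOn_of_hasDerivWithinAt_nonpos hs
    (fun t ht => hasDerivWithinAt_comp_matrix_curve contDiff_penalty (hφ t ht)) fun t _ => ?_
  rw [map_smul, map_neg, fderiv_penalty_landingField, smul_eq_mul]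
  have := mul_nonneg (hc (φ t))
    (mul_nonneg hlam.le (sq_nonneg ‖φ t * ((φ t)ᵀ * φ t - 1)‖))
  linarith

theorem antitoneOn_penalty (hlam : 0 < lam) {s : Set ℝ} (hs : Convex ℝ s)
    (hφ : IsIntegralCurveOn φ (fun _ X => -landingField f lam X) s) :
    AntitoneOn (fun t => penalty (φ t)) s :=
  antitoneOn_penalty_of_rescaled (c := fun _ => 1) hlam (fun _ => zero_le_one) hs
    (by simpa only [one_smul] using hφ)

theorem exists_isLandingSolution (hgrad : LocallyLipschitz (grad f)) (hlam : 0 < lam)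
    (X₀ : Matrix (Fin n) (Fin p) ℝ) : ∃ φ, IsLandingSolution f lam X₀ φ := by
  obtain ⟨R, -, hR⟩ := exists_norm_le_of_penalty_le n p (penalty X₀)
  refine exists_integralCurveOn_Ici_of_norm_le (locallyLipschitz_landingField hgrad lam) X₀ R ?_
  intro c hc γ T h0 hγ t ht
  refine hR _ ?_
  rw [← h0]
  exact antitoneOn_penalty_of_rescaled hlam hc (convex_Icc 0 T) hγ
    (left_mem_Icc.2 (ht.1.trans ht.2)) ht ht.1

theorem IsLandingSolution.eqOn (hgrad : LocallyLipschitz (grad f))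
    {X₀ : Matrix (Fin n) (Fin p) ℝ} {χ : ℝ → Matrix (Fin n) (Fin p) ℝ}
    (hφ : IsLandingSolution f lam X₀ φ) (hχ : IsLandingSolution f lam X₀ χ) :
    EqOn χ φ (Ici 0) :=
  integralCurve_eqOn_Ici (locallyLipschitz_landingField hgrad lam) hχ.2 hφ.2
    (hχ.1.trans hφ.1.symm)

/-- A local minimum of `f` on the Stiefel manifold is a critical point. -/
theorem mem_criticalSet_of_isLocalMinOn (hf : ContDiff ℝ 1 f) (hgrad : LocallyLipschitz (grad f))
    {Y : Matrix (Fin n) (Fin p) ℝ} (hY : Y ∈ stiefel n p)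
    (hmin : IsLocalMinOn f (stiefel n p) Y) : Y ∈ criticalSet f := by
  refine mem_criticalSet_of_psi_eq_zero hY ?_
  -- The flow from `Y`, here with parameter 1, serves as a test curve: its penalty starts at zero
  -- and cannot grow, so it stays on the manifold. Minimality then makes the initial slope
  -- `-½‖ψ(Y)‖²` of `f` nonnegative.
  obtain ⟨φ, h0, hφ⟩ := exists_isLandingSolution hgrad one_pos Y
  have hst : ∀ t ∈ Ici (0 : ℝ), φ t ∈ stiefel n p := by
    intro t ht
    have h := antitoneOn_penalty one_pos (convex_Ici 0) hφ (mem_Ici.2 le_rfl) ht ht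
    simp only [h0, penalty_eq_zero_iff.2 hY] at h
    exact penalty_eq_zero_iff.1 (le_antisymm h (penalty_nonneg _))
  have hderiv := hasDerivWithinAt_comp_matrix_curve hf (hφ 0 (mem_Ici.2 le_rfl))
  have hfield : landingField f 1 Y = psi f Y * Y := by
    have h : Yᵀ * Y = 1 := hY
    rw [landingField, grad_penalty, h]
    simp
  have hslope := hasDerivWithinAt_iff_tendsto_slope.1 hderiv
  rw [h0, map_neg, hfield, fderiv_psi_mul] at hslope
  have htend : Tendsto φ (𝓝[Ici 0 \ {0}] 0) (𝓝[stiefel n p] Y) := by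
    refine tendsto_nhdsWithin_iff.2 ⟨?_, ?_⟩
    · have := (hφ 0 (mem_Ici.2 le_rfl)).continuousWithinAt.tendsto
      rw [h0] at this
      exact this.mono_left (nhdsWithin_mono _ sdiff_subset)
    · filter_upwards [self_mem_nhdsWithin] with t ht using hst t ht.1
  have hne : (𝓝[Ici (0 : ℝ) \ {0}] 0).NeBot := by
    rw [Ici_sdiff_left]; infer_instance
  have hge : 0 ≤ -((1 / 2 : ℝ) * ‖psi f Y‖ ^ 2) := by
    refine ge_of_tendsto hslope ?_
    filter_upwards [htend.eventually hmin, self_mem_nhdsWithin] with t ht ht'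
    rw [slope_def_field, h0]
    have : 0 ≤ t := ht'.1
    exact div_nonneg (sub_nonneg.2 ht) (by linarith)
  have : ‖psi f Y‖ ^ 2 = 0 := le_antisymm (by linarith) (sq_nonneg _)
  simpa using this

/-- Along a bounded trajectory whose penalty tends to zero, `f` plus an exponentially decaying
correction is eventually antitone. -/
theorem exists_antitoneOn_add_exp (hf : ContDiff ℝ 1 f) (hlam : 0 < lam)
    (hφ : IsIntegralCurveOn φ (fun _ X => -landingField f lam X) (Ici 0))
    (h0 : Tendsto (fun t => penalty (φ t)) atTop (𝓝 0)) :
    ∃ a C μ : ℝ, 0 < μ ∧ AntitoneOn (fun t => f (φ t) + C * Real.exp (-μ * t)) (Ici a) := by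
  obtain ⟨R, hR0, hR⟩ := exists_norm_le_of_penalty_le n p (penalty (φ 0))
  have hbd : ∀ t ∈ Ici (0 : ℝ), ‖φ t‖ ≤ R := fun t ht =>
    hR _ (antitoneOn_penalty hlam (convex_Ici 0) hφ (mem_Ici.2 le_rfl) ht ht)
  obtain ⟨K, hK0, hK⟩ := exists_abs_matrix_fderiv_le hf R
  -- Penalty below `1/16` means `‖XᵀX - 1‖ < 1/2`, as `penalty_le_norm_grad` requires.
  obtain ⟨b, hb⟩ := eventually_atTop.1 (h0.eventually_lt_const (show (0 : ℝ) < 1 / 16 by norm_num))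
  set a := max b 0 with ha
  have hsub : Ici a ⊆ Ici (0 : ℝ) := Ici_subset_Ici.2 (le_max_right _ _)
  have hφa := hφ.mono hsub
  set ν : ℝ := lam / R ^ 2 with hν
  have hν0 : 0 < ν := by positivity
  have hsmall : ∀ t ∈ Ici a, ‖(φ t)ᵀ * φ t - 1‖ ≤ 1 / 2 := by
    intro t ht
    have h1 := hb t ((le_max_left _ _).trans ht)
    unfold penalty at h1
    nlinarith [norm_nonneg ((φ t)ᵀ * φ t - 1)]
  have hexp : ∀ (ρ t : ℝ), HasDerivAt (fun t => Real.exp (ρ * t)) (Real.exp (ρ * t) * ρ) t := by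
    intro ρ t
    simpa using ((hasDerivAt_id t).const_mul ρ).exp
  have hdecay : AntitoneOn (fun t => penalty (φ t) * Real.exp (ν * t)) (Ici a) := by
    refine antitoneOn_of_hasDerivWithinAt_nonpos (convex_Ici a) (fun t ht =>
      (hasDerivWithinAt_comp_matrix_curve contDiff_penalty (hφa t ht)).mul
        (hexp ν t).hasDerivWithinAt) fun t ht => ?_
    have h1 := penalty_le_norm_grad (hbd t (hsub ht)) (hsmall t ht)
    rw [map_neg, fderiv_penalty_landingField]
    have h2 : ν * penalty (φ t) ≤ lam * ‖φ t * ((φ t)ᵀ * φ t - 1)‖ ^ 2 := by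
      calc ν * penalty (φ t) ≤ ν * (R ^ 2 * ‖φ t * ((φ t)ᵀ * φ t - 1)‖ ^ 2) := by gcongr
        _ = _ := by rw [hν]; field_simp
    nlinarith [Real.exp_pos (ν * t)]
  set D := penalty (φ a) * Real.exp (ν * a) with hD
  have hD0 : 0 ≤ D := mul_nonneg (penalty_nonneg _) (Real.exp_pos _).le
  -- The rate halves because `‖XᵀX - 1‖` is twice the square root of the penalty.
  set μ := ν / 2 with hμ
  have hμ0 : 0 < μ := by positivity
  have hnorm : ∀ t ∈ Ici a, ‖(φ t)ᵀ * φ t - 1‖ ≤ 2 * Real.sqrt D * Real.exp (-μ * t) := by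
    intro t ht
    have h1 : penalty (φ t) * Real.exp (ν * t) ≤ D := hdecay (mem_Ici.2 le_rfl) ht ht
    refine abs_le_of_sq_le_sq' ?_ (by positivity) |>.2
    have h3 : Real.exp (-μ * t) ^ 2 * Real.exp (ν * t) = 1 := by
      rw [← Real.exp_nat_mul, ← Real.exp_add]
      rw [Real.exp_eq_one_iff]; rw [hμ]; push_cast; ring
    have h4 : penalty (φ t) ≤ D * Real.exp (-μ * t) ^ 2 := by
      calc penalty (φ t) = penalty (φ t) * Real.exp (ν * t) * Real.exp (-μ * t) ^ 2 := by
            rw [mul_assoc, mul_comm (Real.exp (ν * t)), h3, mul_one]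
        _ ≤ _ := by gcongr
    rw [mul_pow, mul_pow, Real.sq_sqrt hD0]
    unfold penalty at h4
    linarith
  -- The constant is chosen so that the derivative of the exponential term cancels the bound on the
  -- drift of `f` due to `λ∇𝒩`.
  refine ⟨a, lam * K * R * (2 * Real.sqrt D) / μ, μ, hμ0, ?_⟩
  refine antitoneOn_of_hasDerivWithinAt_nonpos (convex_Ici a) (fun t ht =>
    (hasDerivWithinAt_comp_matrix_curve hf (hφa t ht)).add
      ((hexp (-μ) t).hasDerivWithinAt.const_mul _)) fun t ht => ?_
  have hX := hbd t (hsub ht)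
  have h1 : |fderiv ℝ f (φ t) (φ t * ((φ t)ᵀ * φ t - 1))| ≤
      K * (R * (2 * Real.sqrt D * Real.exp (-μ * t))) := by
    refine (hK _ hX _).trans ?_
    have := (frobenius_norm_mul (φ t) ((φ t)ᵀ * φ t - 1)).trans
      (mul_le_mul hX (hnorm t ht) (norm_nonneg _) hR0.le)
    gcongr
  have h2 := neg_abs_le (fderiv ℝ f (φ t) (φ t * ((φ t)ᵀ * φ t - 1)))
  rw [map_neg, landingField, grad_penalty, map_add, map_smul, fderiv_psi_mul, smul_eq_mul]
  have h3 : lam * K * R * (2 * Real.sqrt D) / μ * (Real.exp (-μ * t) * -μ) =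
      -(lam * (K * (R * (2 * Real.sqrt D * Real.exp (-μ * t))))) := by
    field_simp
  rw [h3]
  have h4 := mul_le_mul_of_nonneg_left (neg_le_neg h1 |>.trans h2) hlam.le
  nlinarith [sq_nonneg ‖psi f (φ t)‖]

/-- A trajectory with an `ω`-limit point on the Stiefel manifold has vanishing penalty and
convergent objective in the limit. -/
theorem tendsto_penalty_and_objective (hf : ContDiff ℝ 1 f) (hlam : 0 < lam)
    (hφ : IsIntegralCurveOn φ (fun _ X => -landingField f lam X) (Ici 0))
    {Xs : Matrix (Fin n) (Fin p) ℝ} (hXs : Xs ∈ stiefel n p) (hω : IsOmegaLimitPoint φ Xs) :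
    Tendsto (fun t => penalty (φ t)) atTop (𝓝 0) ∧
      Tendsto (fun t => f (φ t)) atTop (𝓝 (f Xs)) := by
  obtain ⟨u, hu, huX⟩ := hω
  have hpen : Tendsto (fun t => penalty (φ t)) atTop (𝓝 0) := by
    refine tendsto_of_antitoneOn_Ici (antitoneOn_penalty hlam (convex_Ici 0) hφ) hu ?_
    rw [← penalty_eq_zero_iff.2 hXs]
    exact (contDiff_penalty.continuous.tendsto Xs).comp huX
  refine ⟨hpen, ?_⟩
  obtain ⟨a, C, μ, hμ, hanti⟩ := exists_antitoneOn_add_exp hf hlam hφ hpen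
  have hexp : Tendsto (fun t => C * Real.exp (-μ * t)) atTop (𝓝 0) := by
    have : Tendsto (fun t : ℝ => -μ * t) atTop atBot :=
      tendsto_id.const_mul_atTop_of_neg (neg_lt_zero.2 hμ)
    simpa using (Real.tendsto_exp_atBot.comp this).const_mul C
  have hlim : Tendsto (fun t => f (φ t) + C * Real.exp (-μ * t)) atTop (𝓝 (f Xs)) := by
    refine tendsto_of_antitoneOn_Ici hanti hu ?_
    simpa using ((hf.continuous.tendsto Xs).comp huX).add (hexp.comp hu)
  simpa using hlim.sub hexp

theorem tendsto_of_isOmegaLimitPoint (hf : ContDiff ℝ 1 f) (hgrad : LocallyLipschitz (grad f))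
    (hlam : 0 < lam) (hφ : IsIntegralCurveOn φ (fun _ X => -landingField f lam X) (Ici 0))
    {Xs : Matrix (Fin n) (Fin p) ℝ} (hmin : IsLocalMinOn f (stiefel n p) Xs)
    (hiso : IsIsolatedCriticalPoint f Xs) (hω : IsOmegaLimitPoint φ Xs) :
    Tendsto φ atTop (𝓝 Xs) := by
  obtain ⟨⟨hXs, -⟩, U, hU, hUcrit⟩ := hiso
  obtain ⟨hpen, hobj⟩ := tendsto_penalty_and_objective hf hlam hφ hXs hω
  obtain ⟨u, hu, huX⟩ := hω
  obtain ⟨r, hr, hball⟩ := Metric.mem_nhds_iff.1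
    (inter_mem hU (eventually_nhdsWithin_iff.1 hmin))
  refine Metric.tendsto_nhds.2 fun ε hε => ?_
  by_contra hnot
  -- With `ρ < ε`, leaving the `ε`-ball forces a crossing of the sphere; with `ρ < r`, the sphere
  -- lies where `Xs` is both minimal and the only critical point.
  set ρ := min ε r / 2 with hρ
  have hρ0 : 0 < ρ := by positivity
  have hρε : ρ < ε := by linarith [min_le_left ε r, lt_min hε hr]
  have hρr : ρ < r := by linarith [min_le_right ε r, lt_min hε hr]
  have hcross : ∃ᶠ t in atTop, φ t ∈ Metric.sphere Xs ρ := by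
    rw [frequently_atTop]
    intro T
    obtain ⟨k, hk, hkT⟩ := ((huX.eventually (Metric.ball_mem_nhds Xs hρ0)).and
      (hu.eventually_ge_atTop (max T 0))).exists
    obtain ⟨b, hb, hbε⟩ := frequently_atTop.1 (not_eventually.1 hnot) (u k)
    have hsub : Icc (u k) b ⊆ Ici 0 := fun t ht => ((le_max_right T 0).trans hkT).trans ht.1
    have hcont : ContinuousOn (fun t => dist (φ t) Xs) (Icc (u k) b) :=
      (continuous_id.dist continuous_const).comp_continuousOn (hφ.continuousOn.mono hsub)
    obtain ⟨t, ht, hts⟩ := intermediate_value_Icc hb hcont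
      ⟨(Metric.mem_ball.1 hk).le, hρε.le.trans (not_lt.1 hbε)⟩
    exact ⟨t, ((le_max_left T 0).trans hkT).trans ht.1, hts⟩
  obtain ⟨Y, hYs, hY⟩ := (isCompact_sphere Xs ρ).exists_mapClusterPt_of_frequently hcross
  have hYst : Y ∈ stiefel n p := penalty_eq_zero_iff.1 <| eq_of_tendsto_of_mapClusterPt
    hpen (hY.continuousAt_comp contDiff_penalty.continuous.continuousAt)
  have hYf : f Y = f Xs := eq_of_tendsto_of_mapClusterPt
    hobj (hY.continuousAt_comp hf.continuous.continuousAt)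
  have hYball : Y ∈ Metric.ball Xs r := by
    rw [Metric.mem_ball, Metric.mem_sphere.1 hYs]; exact hρr
  -- Minimality of `Xs` over the whole open `r`-ball passes to `Y`, an interior point with the same
  -- value.
  have hYmin : IsLocalMinOn f (stiefel n p) Y := by
    refine eventually_nhdsWithin_iff.2 ?_
    filter_upwards [Metric.isOpen_ball.mem_nhds hYball] with Z hZ hZst
    rw [hYf]
    exact (hball hZ).2 hZst
  have hYX := hUcrit Y (hball hYball).1 (mem_criticalSet_of_isLocalMinOn hf hgrad hYst hYmin)
  rw [hYX, Metric.mem_sphere, dist_self] at hYs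
  exact hρ0.ne hYs

end Flow

end Landing

theorem mainTheorem7 (n p : ℕ) (hpn : p ≤ n) (f : Matrix (Fin n) (Fin p) ℝ → ℝ)
    (hf : ContDiff ℝ 1 f) (hgrad : LocallyLipschitz (Landing.grad f))
    (lam : ℝ) (hlam : 0 < lam)
    (X₀ : Matrix (Fin n) (Fin p) ℝ) (hX₀ : X₀ ∈ Landing.fullRank n p) :
    ∃ φ : ℝ → Matrix (Fin n) (Fin p) ℝ,
      Landing.IsLandingSolution f lam X₀ φ ∧
      (∀ χ : ℝ → Matrix (Fin n) (Fin p) ℝ,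
        Landing.IsLandingSolution f lam X₀ χ → EqOn χ φ (Ici 0)) ∧
      ∀ Xs : Matrix (Fin n) (Fin p) ℝ,
        IsLocalMinOn f (Landing.stiefel n p) Xs →
        Landing.IsIsolatedCriticalPoint f Xs →
        Landing.IsOmegaLimitPoint φ Xs →
        Tendsto φ atTop (𝓝 Xs) := by
  obtain ⟨φ, hφ⟩ := Landing.exists_isLandingSolution hgrad hlam X₀
  exact ⟨φ, hφ, fun χ hχ => hφ.eqOn hgrad hχ, fun Xs hmin hiso hω =>
    Landing.tendsto_of_isOmegaLimitPoint hf hgrad hlam hφ.2 hmin hiso hω⟩
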